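/- Let $G$ be a finite simple graph with vertex set $V$, edge set $E$ and $m=|E|$ edges. For a partition $\mathcal A$ of $V$ put, if $m\ge 1$, \[ q_{\mathcal A}(G)=\frac{1}{2m}\sum_{A\in\mathcal A}\ \sum_{u,v\in A}\left(\mathbf 1_{uv\in E}-\frac{\deg(u)\deg(v)}{2m}\right), \] where the inner sum is over ordered pairs $(u,v)\in A\times A$, and let the modularity of $G$ be $q^*(G)=\max_{\mathcal A}q_{\mathcal A}(G)$, the maximum being over all partitions $\mathcal A$ of $V$ (if $m=0$, one puts $q_{\mathcal A}(G)=1$ for every $\mathcal A$). For $n\ge 3$ let $G_{n,2}$ be a uniformly random element of the set of all $2$-regular simple graphs with vertex set $\{1,\dots,n\}$. Then, with high probability, \[ q^*(G_{n,2}) = 1-\frac{2}{\sqrt n}+o\!\left(\frac{\log^2 n}{n}\right); \] that is, there is a deterministic function $f:\mathbb N\to\mathbb R$ with $f(n)=o\big((\log n)^2/n\big)$ as $n\to\infty$ such that \[ \mathbb P\left(\left|\,q^*(G_{n,2})-\Big(1-\frac{2}{\sqrt n}\Big)\right|\le f(n)\right)\longrightarrow 1\qquad (n\to\infty). \] -/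

import Mathlib

open Filter Topology Asymptotics MeasureTheory ProbabilityTheory

namespace SimpleGraph

open Classical in
/-- The modularity score `q_𝓐(G)` of a partition `𝓐` of the vertex set of a finite graph `G`:
`(1 / 2m) ∑_{A ∈ 𝓐} ∑_{u, v ∈ A} (1_{uv ∈ E} - deg u * deg v / 2m)`, where `m` is the number of
edges and `(u, v)` ranges over ordered pairs. By convention it is `1` if `G` has no edges. -/
noncomputable def modularityScore {V : Type*} [Fintype V] (G : SimpleGraph V)
    (P : Finpartition (Finset.univ : Finset V)) : ℝ :=
  if G.edgeFinset.card = 0 then 1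
  else
    1 / (2 * (G.edgeFinset.card : ℝ)) *
      ∑ A ∈ P.parts, ∑ u ∈ A, ∑ v ∈ A,
        ((if G.Adj u v then (1 : ℝ) else 0) -
          (G.degree u : ℝ) * (G.degree v : ℝ) / (2 * (G.edgeFinset.card : ℝ)))

open Classical in
/-- The modularity `q*(G)` of a finite graph: the maximum of `q_𝓐(G)` over all partitions `𝓐` of
the vertex set. -/
noncomputable def modularity {V : Type*} [Fintype V] (G : SimpleGraph V) : ℝ :=
  (Finset.univ : Finset (Finpartition (Finset.univ : Finset V))).sup'
    Finset.univ_nonempty G.modularityScore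

open Classical in
/-- The set of all `r`-regular (simple, labelled) graphs on the vertex set `Fin n`. -/
def regularGraphs (n r : ℕ) : Set (SimpleGraph (Fin n)) :=
  {G | G.IsRegularOfDegree r}

/-- The law of the random `r`-regular graph `G_{n,r}`: the uniform distribution on the set of all
`r`-regular graphs on `Fin n` (the zero measure if that set is empty). -/
noncomputable def randomRegular (n r : ℕ) : Measure (SimpleGraph (Fin n)) :=
  uniformOn (regularGraphs n r)

end SimpleGraph

/-- The events `E n`, which live in the probability spaces `(Ω n, μ n)`, hold with high
probability: their probability tends to `1` as `n → ∞`. -/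
def WithHighProbability {Ω : ℕ → Type*} [∀ n, MeasurableSpace (Ω n)]
    (μ : ∀ n, Measure (Ω n)) (E : ∀ n, Set (Ω n)) : Prop :=
  Tendsto (fun n => μ n (E n)) atTop (𝓝 1)

/-! A 2-regular graph is a disjoint union of cycles; orienting them makes it `permGraph σ`, where
`σ` has no fixed points or 2-cycles. With `n` vertices there are `n` edges, and a part `A`
contributes (internal edges)/n - (|A|/n)^2. Let `c` be the number of cycles.

Deterministically, q* differs from 1 - 2/√n by at most (c + 1)/n
(`abs_modularity_permGraph_sub_le`). From above, every part that is not a union of cycles misses an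
edge, at most `c` parts are such unions, and x^2 ≥ 2x/√n - 1/n for x = |A|/n. From below, the cycles
are cut into arcs of at most ⌈√n⌉ vertices.

It remains to see that `c` is logarithmic with high probability. A graph with at least `t` cycles
has at least 2^t orientations, so there are at most n!/2^t of them (`card_mul_two_pow_le`), while
Hamiltonian cycles alone give at least n!/n^2 graphs (`factorial_le_card_mul`). Taking 2^t ≥ n^3
bounds the failure probability by 1/n. The resulting error is O(log n / n). -/

namespace SimpleGraph

/-! ### Two-regular graphs as permutations. -/

/-- The functional graph of a permutation: `u` and `v` are adjacent if they are distinct and one of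
them is mapped to the other one. -/
def permGraph {V : Type*} (σ : Equiv.Perm V) : SimpleGraph V where
  Adj u v := u ≠ v ∧ (σ u = v ∨ σ v = u)
  symm := ⟨fun _ _ h => ⟨h.1.symm, h.2.symm⟩⟩
  loopless := ⟨fun _ h => h.1 rfl⟩

lemma permGraph_adj {V : Type*} {σ : Equiv.Perm V} (hσ : ∀ v, σ (σ v) ≠ v) {u v : V} :
    (permGraph σ).Adj u v ↔ σ u = v ∨ σ v = u := by
  refine ⟨fun h => h.2, fun h => ⟨?_, h⟩⟩
  rintro rfl
  have h' : σ u = u := h.elim id id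
  exact hσ u (by rw [h', h'])

lemma permGraph_neighborFinset {V : Type*} [DecidableEq V] {σ : Equiv.Perm V}
    (hσ : ∀ v, σ (σ v) ≠ v) (v : V) [Fintype ((permGraph σ).neighborSet v)] :
    (permGraph σ).neighborFinset v = {σ v, σ⁻¹ v} := by
  ext w
  rw [mem_neighborFinset, permGraph_adj hσ, Finset.mem_insert, Finset.mem_singleton,
    Equiv.Perm.eq_inv_iff_eq, eq_comm]

lemma permGraph_degree {V : Type*} {σ : Equiv.Perm V} (hσ : ∀ v, σ (σ v) ≠ v) (v : V)
    [Fintype ((permGraph σ).neighborSet v)] : (permGraph σ).degree v = 2 := by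
  classical
  rw [← card_neighborFinset_eq_degree, permGraph_neighborFinset hσ, Finset.card_pair]
  rw [Ne, Equiv.Perm.eq_inv_iff_eq]
  exact hσ v

/-- Every finite `2`-regular graph can be oriented as the functional graph of a permutation. -/
lemma exists_eq_permGraph {V : Type*} [Fintype V] {G : SimpleGraph V} [G.LocallyFinite]
    (hG : G.IsRegularOfDegree 2) :
    ∃ σ : Equiv.Perm V, (∀ v, σ (σ v) ≠ v) ∧ permGraph σ = G := by
  classical
  have hcard : ∀ v, (G.neighborSet v).ncard = 2 := fun v => by
    rw [← Nat.card_coe_set_eq, Nat.card_eq_fintype_card, card_neighborSet_eq_degree, hG v]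
  have hcyc : G.IsCycles := fun v _ => hcard v
  have hex : ∀ c : G.ConnectedComponent, ∃ (v : V) (p : G.Walk v v), p.IsCycle ∧
      p.toSubgraph.verts = c.supp := by
    intro c
    obtain ⟨v, hv⟩ := c.nonempty_supp
    refine ⟨v, hcyc.exists_cycle_toSubgraph_verts_eq_connectedComponentSupp hv ?_⟩
    exact Set.nonempty_of_ncard_ne_zero (by rw [hcard]; norm_num)
  choose b p hp hverts using hex
  -- The base point occurs at both ends of the closed walk; asking for an index below the length
  -- selects position 0 for it.
  have hidx : ∀ v, ∃ i < (p (G.connectedComponentMk v)).length,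
      (p (G.connectedComponentMk v)).getVert i = v := by
    intro v
    have hv : v ∈ (p (G.connectedComponentMk v)).support := by
      rw [← Walk.mem_verts_toSubgraph, hverts]
      exact rfl
    obtain ⟨i, hi, hil⟩ := Walk.mem_support_iff_exists_getVert.1 hv
    have h3 := (hp (G.connectedComponentMk v)).three_le_length
    rcases hil.lt_or_eq with h | h
    · exact ⟨i, h, hi⟩
    · exact ⟨0, by omega, by
        rw [h, Walk.getVert_length] at hi
        rw [Walk.getVert_zero, hi]⟩
  choose i hi hiv using hidx
  set next : V → V := fun v => (p (G.connectedComponentMk v)).getVert (i v + 1) with hnext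
  have hadj : ∀ v, G.Adj v (next v) := fun v => by
    have := (p (G.connectedComponentMk v)).adj_getVert_succ (hi v)
    rwa [hiv] at this
  have hcomp : ∀ v, G.connectedComponentMk (next v) = G.connectedComponentMk v := fun v =>
    (ConnectedComponent.connectedComponentMk_eq_of_adj (hadj v)).symm
  have hinj : Function.Injective next := by
    intro v w hvw
    have hc : G.connectedComponentMk v = G.connectedComponentMk w := by
      rw [← hcomp v, hvw, hcomp w]
    have hv := hi v
    have hw := hi w
    have ev := hiv v
    have ew := hiv w
    simp only [hnext] at hvw
    rw [hc] at hvw hv ev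
    have := (hp _).getVert_injOn (by rw [Set.mem_ofPred_eq]; omega)
      (by rw [Set.mem_ofPred_eq]; omega) hvw
    exact ev.symm.trans ((show i v = i w by omega) ▸ ew)
  have hnn : ∀ v, next (next v) ≠ v := by
    intro v hv
    have hc := hcomp v
    have h1 := hi v
    have h2 := hi (next v)
    have e1 := hiv v
    have e2 := hiv (next v)
    have e3 : (p (G.connectedComponentMk (next v))).getVert (i (next v) + 1) = v := hv
    rw [hc] at h2 e2 e3
    have h3 := (hp (G.connectedComponentMk v)).three_le_length
    have key := (hp (G.connectedComponentMk v)).getVert_injOn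
    have key' := (hp (G.connectedComponentMk v)).getVert_injOn'
    -- Either the position advances or it wraps to 0; in both cases returning to `v` after two steps
    -- contradicts length at least 3.
    have e4 : i (next v) = i v + 1 ∨ (i (next v) = 0 ∧
        i v + 1 = (p (G.connectedComponentMk v)).length) := by
      rcases Nat.lt_or_ge (i v + 1) (p (G.connectedComponentMk v)).length with h | h
      · left
        exact key' (by rw [Set.mem_ofPred_eq]; omega) (by rw [Set.mem_ofPred_eq]; omega) e2
      · right
        refine ⟨?_, by omega⟩
        refine key' (by rw [Set.mem_ofPred_eq]; omega) (by rw [Set.mem_ofPred_eq]; omega)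
          (e2.trans ?_)
        rw [Walk.getVert_zero]
        have := (p (G.connectedComponentMk v)).getVert_length
        rwa [show (p (G.connectedComponentMk v)).length = i v + 1 by omega] at this
    rcases e4 with e4 | ⟨e4, e5⟩
    · rw [e4] at e3 h2
      rcases Nat.eq_zero_or_pos (i v) with h0 | h0
      · rw [h0, Walk.getVert_zero, ← (p (G.connectedComponentMk v)).getVert_length] at e1
        have := key (by rw [Set.mem_ofPred_eq]; omega) (by rw [Set.mem_ofPred_eq]; omega)
          (e3.trans e1.symm)
        omega
      · have := key (by rw [Set.mem_ofPred_eq]; omega) (by rw [Set.mem_ofPred_eq]; omega)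
          (e3.trans e1.symm)
        omega
    · rw [e4] at e3
      have := key (by rw [Set.mem_ofPred_eq]; omega) (by rw [Set.mem_ofPred_eq]; omega)
        (e3.trans e1.symm)
      omega
  refine ⟨Equiv.ofBijective next (Finite.injective_iff_bijective.1 hinj), hnn, ?_⟩
  set σ := Equiv.ofBijective next (Finite.injective_iff_bijective.1 hinj) with hσ
  ext u v
  have hle : (permGraph σ).neighborFinset u = G.neighborFinset u := by
    refine Finset.eq_of_subset_of_card_le (fun w hw => ?_) ?_
    · rw [mem_neighborFinset, permGraph_adj hnn] at hw
      rw [mem_neighborFinset]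
      rcases hw with rfl | rfl
      · exact hadj u
      · exact (hadj w).symm
    · rw [card_neighborFinset_eq_degree, card_neighborFinset_eq_degree, permGraph_degree hnn, hG u]
  rw [← mem_neighborFinset, hle, mem_neighborFinset]

/-! ### The score of a union of cycles and the upper bound. -/

/-- The number of cycles of a permutation, fixed points included. -/
noncomputable def numCycles {V : Type*} (σ : Equiv.Perm V) : ℕ :=
  Nat.card (Quotient (Equiv.Perm.SameCycle.setoid σ))

lemma card_edgeFinset_permGraph {V : Type*} [Fintype V] {σ : Equiv.Perm V}
    (hσ : ∀ v, σ (σ v) ≠ v) [DecidableRel (permGraph σ).Adj] [Fintype (permGraph σ).edgeSet] :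
    (permGraph σ).edgeFinset.card = Fintype.card V := by
  have h := (permGraph σ).sum_degrees_eq_twice_card_edges
  simp only [permGraph_degree hσ, Finset.sum_const, Finset.card_univ, smul_eq_mul] at h
  have h2 : (permGraph σ).edgeFinset.card * 2 = Fintype.card V * 2 := by
    rw [h, mul_comm]
    congr!
  omega

open Classical in
lemma sum_adj_permGraph {V : Type*} {σ : Equiv.Perm V} (hσ : ∀ v, σ (σ v) ≠ v) (A : Finset V) :
    ∑ u ∈ A, ∑ v ∈ A, (if (permGraph σ).Adj u v then (1 : ℝ) else 0) =
      2 * ((A.filter fun u => σ u ∈ A).card : ℝ) := by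
  have h : ∀ u v, (if (permGraph σ).Adj u v then (1 : ℝ) else 0) =
      (if σ u = v then 1 else 0) + (if σ v = u then 1 else 0) := by
    intro u v
    rw [permGraph_adj hσ]
    by_cases h1 : σ u = v
    · have h2 : σ v ≠ u := by rw [← h1]; exact hσ u
      simp [h1, h2]
    · simp [h1]
  have h1 : ∑ u ∈ A, ∑ v ∈ A, (if σ u = v then (1 : ℝ) else 0) =
      ((A.filter fun u => σ u ∈ A).card : ℝ) := by
    simp [Finset.sum_ite_eq, Finset.sum_boole]
  simp_rw [h, Finset.sum_add_distrib]
  rw [Finset.sum_comm (f := fun u v => if σ v = u then (1 : ℝ) else 0), h1]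
  ring

open Classical in
lemma modularityScore_permGraph {V : Type*} [Fintype V] [Nonempty V] {σ : Equiv.Perm V}
    (hσ : ∀ v, σ (σ v) ≠ v) (P : Finpartition (Finset.univ : Finset V)) :
    (permGraph σ).modularityScore P = ∑ A ∈ P.parts,
      (((A.filter fun u => σ u ∈ A).card : ℝ) / Fintype.card V -
        ((A.card : ℝ) / Fintype.card V) ^ 2) := by
  have hn : (Fintype.card V : ℝ) ≠ 0 := by exact_mod_cast Fintype.card_ne_zero
  rw [modularityScore, if_neg (by rw [card_edgeFinset_permGraph hσ]; exact Fintype.card_ne_zero),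
    Finset.mul_sum]
  refine Finset.sum_congr rfl fun A _ => ?_
  simp_rw [permGraph_degree hσ, card_edgeFinset_permGraph hσ, Finset.sum_sub_distrib]
  rw [sum_adj_permGraph hσ]
  simp only [Finset.sum_const, nsmul_eq_mul]
  field_simp
  push_cast
  ring

lemma sum_card_parts_univ {V : Type*} [Fintype V] [DecidableEq V]
    (P : Finpartition (Finset.univ : Finset V)) :
    ∑ A ∈ P.parts, (A.card : ℝ) = Fintype.card V := by
  exact_mod_cast P.sum_card_parts

lemma mk_apply_eq_mk {V : Type*} (σ : Equiv.Perm V) (v : V) :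
    Quotient.mk (Equiv.Perm.SameCycle.setoid σ) (σ v) = Quotient.mk _ v :=
  Quotient.sound (s := Equiv.Perm.SameCycle.setoid σ)
    (Equiv.Perm.sameCycle_apply_left.2 Equiv.Perm.SameCycle.rfl)

lemma numCycles_eq_card {V : Type*} (σ : Equiv.Perm V)
    [Fintype (Quotient (Equiv.Perm.SameCycle.setoid σ))] :
    numCycles σ = Fintype.card (Quotient (Equiv.Perm.SameCycle.setoid σ)) :=
  Nat.card_eq_fintype_card

open Classical in
/-- At most `numCycles σ` parts of a partition are mapped into themselves by `σ`. -/
lemma card_closed_parts_le {V : Type*} [Fintype V] [Nonempty V] (σ : Equiv.Perm V)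
    (P : Finpartition (Finset.univ : Finset V)) :
    (P.parts.filter fun A => ∀ u ∈ A, σ u ∈ A).card ≤ numCycles σ := by
  rw [numCycles_eq_card, ← Finset.card_univ]
  have hne : ∀ A ∈ P.parts, A.Nonempty := fun A hA => P.nonempty_of_mem_parts hA
  choose! x hx using hne
  refine Finset.card_le_card_of_injOn
    (fun A => (Quotient.mk (Equiv.Perm.SameCycle.setoid σ) (x A)))
    (fun _ _ => Finset.mem_univ _) ?_
  intro A hA B hB hAB
  rw [Finset.mem_coe, Finset.mem_filter] at hA hB
  obtain ⟨k, hk⟩ := (Quotient.exact hAB : σ.SameCycle (x A) (x B)).exists_nat_pow_eq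
  have hmem : ∀ j : ℕ, (σ ^ j) (x A) ∈ A := by
    intro j
    induction j with
    | zero => exact hx A hA.1
    | succ j ih => rw [pow_succ', Equiv.Perm.mul_apply]; exact hA.2 _ ih
  exact P.eq_of_mem_parts hA.1 hB.1 (hk ▸ hmem k) (hx B hB.1)

-- Each part is bounded by a linear function of its size, plus 1/n if `σ` maps it into itself. The
-- linear terms sum to 1 - 2/√n because the sizes sum to n.
open Classical in
lemma modularityScore_permGraph_le {V : Type*} [Fintype V] [Nonempty V] {σ : Equiv.Perm V}
    (hσ : ∀ v, σ (σ v) ≠ v) (P : Finpartition (Finset.univ : Finset V)) :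
    (permGraph σ).modularityScore P ≤
      1 - 2 / Real.sqrt (Fintype.card V) + numCycles σ / Fintype.card V := by
  rw [modularityScore_permGraph hσ]
  set n : ℝ := (Fintype.card V : ℝ) with hn_def
  have hn : 0 < n := by rw [hn_def]; exact_mod_cast Fintype.card_pos
  have hsq : Real.sqrt n ^ 2 = n := Real.sq_sqrt hn.le
  have hr : 0 < Real.sqrt n := Real.sqrt_pos.2 hn
  have hA : ∀ A ∈ P.parts,
      ((A.filter fun u => σ u ∈ A).card : ℝ) / n - ((A.card : ℝ) / n) ^ 2 ≤
        (A.card : ℝ) * (1 / n - 2 / Real.sqrt n / n) +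
          (if ∀ u ∈ A, σ u ∈ A then 1 else 0) / n := by
    intro A _
    have hle : ((A.filter fun u => σ u ∈ A).card : ℝ) + 1 ≤
        (A.card : ℝ) + (if ∀ u ∈ A, σ u ∈ A then 1 else 0) := by
      split_ifs with h
      · gcongr
        exact Finset.filter_subset _ _
      · push Not at h
        obtain ⟨u, hu, hu'⟩ := h
        have hss : A.filter (fun u => σ u ∈ A) ⊂ A := Finset.filter_ssubset.2 ⟨u, hu, hu'⟩
        have := Finset.card_lt_card hss
        rw [add_zero]
        exact_mod_cast this
    have h1 := div_le_div_of_nonneg_right hle hn.le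
    rw [add_div, add_div] at h1
    -- Tangent-line bound for the square, with equality at the optimal part size √n.
    have h2 : 0 ≤ (1 / Real.sqrt n - (A.card : ℝ) / n) ^ 2 := sq_nonneg _
    have h3 : (1 / Real.sqrt n) ^ 2 = 1 / n := by rw [div_pow, hsq, one_pow]
    have h4 : (A.card : ℝ) * (1 / n - 2 / Real.sqrt n / n) =
        (A.card : ℝ) / n - 2 * (1 / Real.sqrt n) * ((A.card : ℝ) / n) := by ring
    rw [h4]
    nlinarith
  refine (Finset.sum_le_sum hA).trans ?_
  rw [Finset.sum_add_distrib, ← Finset.sum_mul, sum_card_parts_univ, ← hn_def,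
    ← Finset.sum_div, Finset.sum_boole]
  have h5 : n * (1 / n - 2 / Real.sqrt n / n) = 1 - 2 / Real.sqrt n := by field_simp
  rw [h5]
  gcongr
  exact card_closed_parts_le σ P

/-! ### The lower bound: cutting cycles into arcs. -/

open Classical in
lemma sum_parts_eq_sum_univ {V : Type*} [Fintype V] (P : Finpartition (Finset.univ : Finset V))
    (g : V → ℝ) : ∑ A ∈ P.parts, ∑ u ∈ A, g u = ∑ u, g u := by
  conv_rhs => rw [← P.biUnion_parts, Finset.sum_biUnion P.supIndep.pairwiseDisjoint]
  rfl

open Classical in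
/-- A lower bound for the modularity of a union of cycles from the fibres of a function that has
few changes along the cycles and small fibres. -/
lemma le_modularity_permGraph {V ι : Type*} [Fintype V] [Nonempty V] [DecidableEq ι] {σ : Equiv.Perm V}
    (hσ : ∀ v, σ (σ v) ≠ v) (f : V → ι) (s : ℝ)
    (hs : ∀ v, ((Finset.univ.filter fun w => f v = f w).card : ℝ) ≤ s) :
    1 - ((Finset.univ.filter fun v => f (σ v) ≠ f v).card : ℝ) / Fintype.card V -
      s / Fintype.card V ≤ (permGraph σ).modularity := by
  set P := Finpartition.ofSetoid (Setoid.ker f) with hP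
  refine le_trans ?_ (Finset.le_sup' (permGraph σ).modularityScore (Finset.mem_univ P))
  rw [modularityScore_permGraph hσ]
  set n : ℝ := (Fintype.card V : ℝ) with hn_def
  have hn : 0 < n := by rw [hn_def]; exact_mod_cast Fintype.card_pos
  have hparts : ∀ A ∈ P.parts, ∃ v, A = Finset.univ.filter fun w => f v = f w := by
    intro A hA
    obtain ⟨v, -, hv⟩ := Finset.mem_image.1 hA
    exact ⟨v, hv.symm⟩
  have hA : ∀ A ∈ P.parts, ∑ u ∈ A, (1 / n - s / n / n - (if f (σ u) ≠ f u then 1 else 0) / n) ≤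
      ((A.filter fun u => σ u ∈ A).card : ℝ) / n - ((A.card : ℝ) / n) ^ 2 := by
    intro A hA
    obtain ⟨v, rfl⟩ := hparts A hA
    set A := Finset.univ.filter fun w => f v = f w with hAdef
    have hc : ((A.filter fun u => σ u ∈ A).card : ℝ) =
        A.card - ∑ u ∈ A, (if f (σ u) ≠ f u then (1 : ℝ) else 0) := by
      rw [Finset.sum_boole, eq_sub_iff_add_eq, ← Nat.cast_add,
        ← Finset.card_filter_add_card_filter_not (s := A) (fun u => σ u ∈ A)]
      congr 3
      refine Finset.filter_congr fun u hu => ?_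
      have hu' : f v = f u := (Finset.mem_filter.1 hu).2
      simp only [hAdef, Finset.mem_filter, Finset.mem_univ, true_and, hu', ne_eq, eq_comm]
    have hsA : (A.card : ℝ) / n * ((A.card : ℝ) / n) ≤ (A.card : ℝ) / n * (s / n) := by
      gcongr
      exact hs v
    rw [hc, Finset.sum_sub_distrib, Finset.sum_const, ← Finset.sum_div, nsmul_eq_mul, sub_div]
    have : (A.card : ℝ) * (1 / n - s / n / n) = (A.card : ℝ) / n - (A.card : ℝ) / n * (s / n) := by
      ring
    rw [this]
    nlinarith
  refine le_trans ?_ (Finset.sum_le_sum hA)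
  rw [sum_parts_eq_sum_univ, Finset.sum_sub_distrib, Finset.sum_const, ← Finset.sum_div,
    Finset.sum_boole, Finset.card_univ, nsmul_eq_mul, ← hn_def]
  apply le_of_eq
  field_simp
  ring

open Classical in
/-- An enumeration of each cycle of `σ` that advances by one along `σ`, except at one point of each
cycle. -/
lemma exists_cycle_index {V : Type*} [Fintype V] (σ : Equiv.Perm V) :
    ∃ idx : V → ℕ, (∀ v w, σ.SameCycle v w → idx v = idx w → v = w) ∧
      (Finset.univ.filter fun v => idx (σ v) ≠ idx v + 1).card ≤ numCycles σ := by
  let r : V → V := fun v => (Quotient.mk (Equiv.Perm.SameCycle.setoid σ) v).out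
  have hr : ∀ v, σ.SameCycle (r v) v := fun v =>
    Quotient.mk_out (s := Equiv.Perm.SameCycle.setoid σ) v
  have hrr : ∀ v w, σ.SameCycle v w → r v = r w := fun v w h =>
    congrArg Quotient.out (Quotient.sound (s := Equiv.Perm.SameCycle.setoid σ) h)
  have hex : ∀ v, ∃ k : ℕ, (σ ^ k) (r v) = v := fun v => (hr v).exists_nat_pow_eq
  have hspec : ∀ v, (σ ^ Nat.find (hex v)) (r v) = v := fun v => Nat.find_spec (hex v)
  have hmin : ∀ v k, (σ ^ k) (r v) = v → Nat.find (hex v) ≤ k := fun v k hk => Nat.find_min' _ hk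
  have hrσ : ∀ v, r (σ v) = r v := fun v =>
    hrr _ _ (Equiv.Perm.sameCycle_apply_left.2 Equiv.Perm.SameCycle.rfl)
  refine ⟨fun v => Nat.find (hex v), fun v w h hvw => ?_, ?_⟩
  · have hvw' : Nat.find (hex v) = Nat.find (hex w) := hvw
    rw [← hspec v, hvw', hrr v w h, hspec w]
  · rw [numCycles_eq_card, ← Finset.card_univ]
    refine Finset.card_le_card_of_injOn
      (fun v => (Quotient.mk (Equiv.Perm.SameCycle.setoid σ) v)) (fun _ _ => Finset.mem_univ _) ?_
    -- The index is the least number of steps from the representative `r v`, so it can only fail to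
    -- advance on returning there.
    have key : ∀ v, Nat.find (hex (σ v)) ≠ Nat.find (hex v) + 1 → σ v = r v := by
      intro v hv
      have h1 : Nat.find (hex (σ v)) ≤ Nat.find (hex v) + 1 :=
        hmin _ _ (by rw [hrσ, pow_succ', Equiv.Perm.mul_apply, hspec])
      have h2 := hspec (σ v)
      rcases hk : Nat.find (hex (σ v)) with _ | k
      · rw [hk, hrσ] at h2
        exact h2.symm
      · rw [hk, hrσ, pow_succ', Equiv.Perm.mul_apply] at h2
        have := hmin v k (σ.injective h2)
        omega
    intro v hv w hw hvw
    rw [Finset.mem_coe, Finset.mem_filter] at hv hw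
    apply σ.injective
    rw [key v hv.2, key w hw.2, hrr v w (Quotient.exact hvw)]

/-- Cutting each cycle into blocks of `s = ⌈√n⌉` consecutive indices costs about √n edges plus at
most one per cycle; the extra 1/n pays for rounding `s` up. -/
lemma sub_le_modularity_permGraph {V : Type*} [Fintype V] [Nonempty V] {σ : Equiv.Perm V}
    (hσ : ∀ v, σ (σ v) ≠ v) :
    1 - 2 / Real.sqrt (Fintype.card V) - (numCycles σ + 1) / Fintype.card V ≤
      (permGraph σ).modularity := by
  classical
  obtain ⟨idx, hinj, hcut⟩ := exists_cycle_index σ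
  set n : ℝ := (Fintype.card V : ℝ) with hn_def
  have hn : 0 < n := by rw [hn_def]; exact_mod_cast Fintype.card_pos
  have hsq : Real.sqrt n ^ 2 = n := Real.sq_sqrt hn.le
  have hrt : 0 < Real.sqrt n := Real.sqrt_pos.2 hn
  set s : ℕ := ⌈Real.sqrt n⌉₊ with hs_def
  have hs : 0 < s := Nat.ceil_pos.2 hrt
  have hsR : (0 : ℝ) < s := by exact_mod_cast hs
  have hs1 : Real.sqrt n ≤ s := Nat.le_ceil _
  have hs2 : (s : ℝ) ≤ Real.sqrt n + 1 := (Nat.ceil_lt_add_one hrt.le).le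
  -- Averaging over residues mod `s`: some class contains at most n/s vertices, and the cuts are
  -- made there.
  obtain ⟨r, hr, hfib⟩ := Finset.exists_card_fiber_le_of_card_le_nsmul
    (s := (Finset.univ : Finset V)) (t := Finset.range s) (f := fun v => idx v % s) (b := n / s)
    (Finset.nonempty_range_iff.2 hs.ne')
    (by
      rw [Finset.card_univ, Finset.card_range, nsmul_eq_mul, ← hn_def]
      apply le_of_eq
      field_simp)
  rw [Finset.mem_range] at hr
  -- This shift makes a block end exactly after the indices congruent to `r` mod `s`.
  set o := s - 1 - r with ho
  let f : V → Quotient (Equiv.Perm.SameCycle.setoid σ) × ℕ := fun v =>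
    (Quotient.mk _ v, (idx v + o) / s)
  have hcard : ∀ v, ((Finset.univ.filter fun w => f v = f w).card : ℝ) ≤ s := by
    intro v
    have : (Finset.univ.filter fun w => f v = f w).card ≤
        (Finset.Ico (s * ((idx v + o) / s)) (s * ((idx v + o) / s) + s)).card := by
      refine Finset.card_le_card_of_injOn (fun w => idx w + o) ?_ ?_
      · intro w hw
        rw [Finset.mem_coe, Finset.mem_filter] at hw
        have h2 : (idx v + o) / s = (idx w + o) / s := congrArg Prod.snd hw.2
        rw [Finset.mem_coe, Finset.mem_Ico, h2]
        change _ ≤ idx w + o ∧ idx w + o < _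
        have h3 := Nat.div_add_mod (idx w + o) s
        have h4 := Nat.mod_lt (idx w + o) hs
        constructor <;> omega
      · intro w hw w' hw' hww
        rw [Finset.mem_coe, Finset.mem_filter] at hw hw'
        have h1 : Quotient.mk (Equiv.Perm.SameCycle.setoid σ) w = Quotient.mk _ w' :=
          congrArg Prod.fst (hw.2.symm.trans hw'.2)
        have h2 : idx w + o = idx w' + o := hww
        exact hinj w w' (Quotient.exact h1) (by omega)
    rw [Nat.card_Ico] at this
    exact_mod_cast this.trans (by omega)
  have hlow := le_modularity_permGraph hσ f s hcard
  have hchange : ((Finset.univ.filter fun v => f (σ v) ≠ f v).card : ℝ) ≤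
      numCycles σ + n / s := by
    have hsub : (Finset.univ.filter fun v => f (σ v) ≠ f v) ⊆
        (Finset.univ.filter fun v => idx (σ v) ≠ idx v + 1) ∪
          (Finset.univ.filter fun v => idx v % s = r) := by
      intro v hv
      rw [Finset.mem_filter] at hv
      simp only [Finset.mem_union, Finset.mem_filter, Finset.mem_univ, true_and]
      by_contra! hcon
      apply hv.2
      have h1 : Quotient.mk (Equiv.Perm.SameCycle.setoid σ) (σ v) = Quotient.mk _ v :=
        mk_apply_eq_mk σ v
      refine Prod.ext h1 ?_
      change (idx (σ v) + o) / s = (idx v + o) / s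
      rw [hcon.1, add_right_comm, Nat.succ_div, if_neg, add_zero]
      rintro ⟨k, hk⟩
      apply hcon.2
      rcases k with _ | k
      · omega
      · rw [mul_add_one] at hk
        have : idx v = s * k + r := by omega
        rw [this, Nat.mul_add_mod, Nat.mod_eq_of_lt hr]
    calc ((Finset.univ.filter fun v => f (σ v) ≠ f v).card : ℝ)
        ≤ ((Finset.univ.filter fun v => idx (σ v) ≠ idx v + 1).card : ℝ) +
          ((Finset.univ.filter fun v => idx v % s = r).card : ℝ) := by
          exact_mod_cast (Finset.card_le_card hsub).trans (Finset.card_union_le _ _)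
      _ ≤ numCycles σ + n / s := add_le_add (by exact_mod_cast hcut) hfib
  have h1 := div_le_div_of_nonneg_right hchange hn.le
  have h2 : (numCycles σ + n / s) / n = numCycles σ / n + 1 / s := by field_simp
  have h3 : 1 / (s : ℝ) ≤ 1 / Real.sqrt n := one_div_le_one_div_of_le hrt hs1
  have h4 : (s : ℝ) / n ≤ 1 / Real.sqrt n + 1 / n := by
    refine (div_le_div_of_nonneg_right hs2 hn.le).trans (le_of_eq ?_)
    rw [add_div, Real.sqrt_div_self']
  rw [h2] at h1
  have h5 : 2 / Real.sqrt n = 1 / Real.sqrt n + 1 / Real.sqrt n := by ring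
  have h6 : (numCycles σ + 1 : ℝ) / n = numCycles σ / n + 1 / n := by ring
  rw [h5, h6]
  linarith

lemma abs_modularity_permGraph_sub_le {V : Type*} [Fintype V] [Nonempty V] {σ : Equiv.Perm V}
    (hσ : ∀ v, σ (σ v) ≠ v) :
    |(permGraph σ).modularity - (1 - 2 / Real.sqrt (Fintype.card V))| ≤
      (numCycles σ + 1) / Fintype.card V := by
  have h1 := sub_le_modularity_permGraph hσ
  have h2 : (permGraph σ).modularity ≤
      1 - 2 / Real.sqrt (Fintype.card V) + numCycles σ / Fintype.card V :=
    Finset.sup'_le _ _ fun P _ => modularityScore_permGraph_le hσ P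
  have h3 : (numCycles σ + 1 : ℝ) / Fintype.card V =
      numCycles σ / Fintype.card V + 1 / Fintype.card V := by ring
  have h4 : (0 : ℝ) ≤ 1 / Fintype.card V := by positivity
  rw [abs_le]
  constructor <;> linarith

/-! ### Counting orientations and 2-regular graphs. -/

lemma mk_inv_apply_eq_mk {V : Type*} (σ : Equiv.Perm V) (v : V) :
    Quotient.mk (Equiv.Perm.SameCycle.setoid σ) (σ⁻¹ v) = Quotient.mk _ v := by
  have h := mk_apply_eq_mk σ (σ⁻¹ v)
  rw [← h]
  exact congrArg _ (σ.apply_symm_apply v)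

open Classical in
/-- Reverse the direction of the cycles of `σ` that belong to `S`. -/
noncomputable def reverseCycles {V : Type*} (σ : Equiv.Perm V)
    (S : Finset (Quotient (Equiv.Perm.SameCycle.setoid σ))) : Equiv.Perm V where
  toFun v := if Quotient.mk _ v ∈ S then σ⁻¹ v else σ v
  invFun v := if Quotient.mk _ v ∈ S then σ v else σ⁻¹ v
  left_inv v := by
    have h1 := mk_apply_eq_mk σ v
    have h2 := mk_inv_apply_eq_mk σ v
    by_cases h : Quotient.mk (Equiv.Perm.SameCycle.setoid σ) v ∈ S
    · simp only [if_pos h, h2]; exact σ.apply_symm_apply v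
    · simp only [if_neg h, h1]; exact σ.symm_apply_apply v
  right_inv v := by
    have h1 := mk_apply_eq_mk σ v
    have h2 := mk_inv_apply_eq_mk σ v
    by_cases h : Quotient.mk (Equiv.Perm.SameCycle.setoid σ) v ∈ S
    · simp only [if_pos h, h1]; exact σ.symm_apply_apply v
    · simp only [if_neg h, h2]; exact σ.apply_symm_apply v

lemma permGraph_reverseCycles {V : Type*} (σ : Equiv.Perm V)
    (S : Finset (Quotient (Equiv.Perm.SameCycle.setoid σ))) :
    permGraph (reverseCycles σ S) = permGraph σ := by
  classical
  have happ : ∀ v, reverseCycles σ S v = if Quotient.mk _ v ∈ S then σ⁻¹ v else σ v := fun v => rfl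
  have hsame : ∀ u v, (σ u = v ∨ σ v = u) →
      (Quotient.mk (Equiv.Perm.SameCycle.setoid σ) u ∈ S ↔ Quotient.mk _ v ∈ S) := by
    intro u v h
    rw [Quotient.sound (s := Equiv.Perm.SameCycle.setoid σ) (a := u) (b := v)]
    rcases h with rfl | rfl
    · exact Equiv.Perm.sameCycle_apply_right.2 Equiv.Perm.SameCycle.rfl
    · exact Equiv.Perm.sameCycle_apply_left.2 Equiv.Perm.SameCycle.rfl
  have key : ∀ u v, reverseCycles σ S u = v → σ u = v ∨ σ v = u := by
    intro u v h
    rw [happ] at h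
    split_ifs at h
    · exact Or.inr (Equiv.Perm.inv_eq_iff_eq.1 h).symm
    · exact Or.inl h
  have key' : ∀ u v, σ u = v → reverseCycles σ S u = v ∨ reverseCycles σ S v = u := by
    intro u v h
    have hs := hsame u v (Or.inl h)
    by_cases hu : Quotient.mk (Equiv.Perm.SameCycle.setoid σ) u ∈ S
    · right
      rw [happ, if_pos (hs.1 hu), Equiv.Perm.inv_eq_iff_eq, h]
    · left
      rw [happ, if_neg hu, h]
  ext u v
  refine and_congr_right fun _ => ⟨fun h => ?_, fun h => ?_⟩
  · exact h.elim (key u v) fun h => (key v u h).symm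
  · exact h.elim (key' u v) fun h => (key' v u h).symm

-- Each cycle can be reversed independently without changing the graph. Distinct choices give
-- distinct permutations, since σ⁻¹ v ≠ σ v reveals whether the cycle of `v` was reversed.
open Classical in
lemma two_pow_numCycles_le {V : Type*} [Fintype V] {σ : Equiv.Perm V} (hσ : ∀ v, σ (σ v) ≠ v) :
    2 ^ numCycles σ ≤ (Finset.univ.filter fun π : Equiv.Perm V => permGraph π = permGraph σ).card := by
  rw [numCycles_eq_card, ← Fintype.card_finset, ← Finset.card_univ]
  refine Finset.card_le_card_of_injOn (reverseCycles σ) (fun S _ => ?_) fun S _ T _ h => ?_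
  · simpa using permGraph_reverseCycles σ S
  · have hmem : ∀ (S : Finset (Quotient (Equiv.Perm.SameCycle.setoid σ))) (v : V),
        Quotient.mk _ v ∈ S ↔ reverseCycles σ S v = σ⁻¹ v := by
      intro S v
      change _ ↔ (if Quotient.mk _ v ∈ S then σ⁻¹ v else σ v) = σ⁻¹ v
      by_cases hv : Quotient.mk (Equiv.Perm.SameCycle.setoid σ) v ∈ S
      · simp [hv]
      · simp only [hv, if_false, false_iff]
        rw [Equiv.Perm.eq_inv_iff_eq]
        exact hσ v
    ext q
    induction q using Quotient.inductionOn with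
    | h v => rw [hmem S, hmem T, h]

/-- Few `2`-regular graphs have many cycles. -/
lemma card_mul_two_pow_le {V : Type*} [Fintype V] [DecidableEq V] (B : Finset (SimpleGraph V))
    (t : ℕ)
    (hB : ∀ G ∈ B, ∃ σ : Equiv.Perm V, (∀ v, σ (σ v) ≠ v) ∧ permGraph σ = G ∧ t ≤ numCycles σ) :
    B.card * 2 ^ t ≤ (Fintype.card V).factorial := by
  classical
  calc B.card * 2 ^ t = ∑ _G ∈ B, 2 ^ t := by rw [Finset.sum_const, smul_eq_mul]
    _ ≤ ∑ G ∈ B, ((Finset.univ.filter fun π : Equiv.Perm V => permGraph π ∈ B).filter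
          fun π => permGraph π = G).card := by
        refine Finset.sum_le_sum fun G hG => ?_
        obtain ⟨σ, hσ, rfl, ht⟩ := hB G hG
        refine (Nat.pow_le_pow_right two_pos ht).trans ((two_pow_numCycles_le hσ).trans ?_)
        refine Finset.card_le_card fun π hπ => ?_
        rw [Finset.mem_filter] at hπ ⊢
        exact ⟨by simpa [hπ.2] using hG, hπ.2⟩
    _ = (Finset.univ.filter fun π : Equiv.Perm V => permGraph π ∈ B).card :=
        (Finset.card_eq_sum_card_fiberwise fun π hπ => by simpa using hπ).symm
    _ ≤ Fintype.card (Equiv.Perm V) := Finset.card_le_univ _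
    _ = (Fintype.card V).factorial := Fintype.card_perm

open Fin.NatCast in
/-- Relabelling a Hamiltonian cycle gives many `2`-regular graphs. -/
lemma factorial_le_card_mul (k : ℕ) (R : Finset (SimpleGraph (Fin (k + 3))))
    (hR : ∀ σ : Equiv.Perm (Fin (k + 3)), (∀ v, σ (σ v) ≠ v) → permGraph σ ∈ R) :
    (k + 3).factorial ≤ R.card * (k + 3) ^ 2 := by
  classical
  let c : Equiv.Perm (Fin (k + 3)) := Equiv.addRight 1
  have hc : ∀ i, c i = i + 1 := fun i => rfl
  have htwo : ∀ i : Fin (k + 3), i + 1 + 1 ≠ i := by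
    intro i h
    rw [add_assoc, add_eq_left] at h
    have := congrArg Fin.val h
    rw [Fin.val_add, Fin.val_one, Fin.val_zero, Nat.mod_eq_of_lt (by omega)] at this
    omega
  let ρ : Equiv.Perm (Fin (k + 3)) → Equiv.Perm (Fin (k + 3)) := fun τ => τ * c * τ⁻¹
  have hρ : ∀ τ i, ρ τ (τ i) = τ (i + 1) := fun τ i => by simp [ρ, hc]
  have hρ2 : ∀ τ v, ρ τ (ρ τ v) ≠ v := by
    intro τ v
    obtain ⟨i, rfl⟩ := τ.surjective v
    rw [hρ, hρ]
    exact fun h => htwo i (τ.injective h)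
  have hcard : (k + 3).factorial = (Finset.univ : Finset (Equiv.Perm (Fin (k + 3)))).card := by
    rw [Finset.card_univ, Fintype.card_perm, Fintype.card_fin]
  have hcard' : R.card * (k + 3) ^ 2 =
      (R ×ˢ (Finset.univ : Finset (Fin (k + 3) × Fin (k + 3)))).card := by
    rw [Finset.card_product, Finset.card_univ, Fintype.card_prod, Fintype.card_fin, sq]
  rw [hcard, hcard']
  -- A labelling is recovered from its cycle graph, a starting vertex and the next vertex; this is
  -- the source of the factor n^2.
  refine Finset.card_le_card_of_injOn (fun τ => (permGraph (ρ τ), τ 0, τ 1))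
    (fun τ _ => Finset.mem_coe.2 (Finset.mem_product.2 ⟨hR _ (hρ2 τ), Finset.mem_univ _⟩)) ?_
  intro τ _ τ' _ h
  have hG : permGraph (ρ τ) = permGraph (ρ τ') := congrArg Prod.fst h
  have h0 : τ 0 = τ' 0 := congrArg (fun x => x.2.1) h
  have h1 : τ 1 = τ' 1 := congrArg (fun x => x.2.2) h
  -- Walking along the cycle: of the two neighbours of the current vertex, the next one is the one
  -- not just visited.
  have key : ∀ m : ℕ, τ (m : Fin (k + 3)) = τ' (m : Fin (k + 3)) ∧
      τ ((m : Fin (k + 3)) + 1) = τ' ((m : Fin (k + 3)) + 1) := by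
    intro m
    induction m with
    | zero => simpa using ⟨h0, h1⟩
    | succ m ih =>
      push_cast
      refine ⟨ih.2, ?_⟩
      have hadj : (permGraph (ρ τ')).Adj (τ' ((m : Fin (k + 3)) + 1))
          (τ' ((m : Fin (k + 3)) + 1 + 1)) := (permGraph_adj (hρ2 τ')).2 (Or.inl (hρ τ' _))
      rw [← hG, ← ih.2, permGraph_adj (hρ2 τ)] at hadj
      rcases hadj with hadj | hadj
      · rw [← hadj, hρ]
      · rw [← hρ τ] at hadj
        have := (ρ τ).injective hadj
        rw [ih.1] at this
        exact absurd (τ'.injective this) (htwo _)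
  ext i
  have := (key i.val).1
  rw [Fin.cast_val_eq_self] at this
  rw [this]

/-! ### From counting to probability, and the asymptotics. -/

lemma measurableSet_of_finite {V : Type*} [Finite V] (S : Set (SimpleGraph V)) :
    MeasurableSet S := by
  have h : S = ⋃ G ∈ S, edgeSet ⁻¹' {G.edgeSet} := by
    ext H
    simp only [Set.mem_iUnion, Set.mem_preimage, Set.mem_singleton_iff, edgeSet_inj, exists_prop,
      exists_eq_right']
  rw [h]
  exact MeasurableSet.biUnion S.to_countable fun G _ =>
    measurable_edgeSet (Set.toFinite _).measurableSet

open Classical in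
/-- If a property fails only for `2`-regular graphs with at least `t` cycles, and `2 ^ t` is at
least `n ^ 3`, then it fails with probability at most `1 / n`. -/
lemma one_sub_inv_le_randomRegular_two (k t : ℕ) (ht : (k + 3) ^ 3 ≤ 2 ^ t)
    (E : Set (SimpleGraph (Fin (k + 3))))
    (hE : ∀ σ : Equiv.Perm (Fin (k + 3)), (∀ v, σ (σ v) ≠ v) → numCycles σ < t → permGraph σ ∈ E) :
    1 - ((k + 3 : ℕ) : ENNReal)⁻¹ ≤ randomRegular (k + 3) 2 E := by
  set R : Finset (SimpleGraph (Fin (k + 3))) :=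
    Finset.univ.filter fun G => G ∈ regularGraphs (k + 3) 2 with hRdef
  set B : Finset (SimpleGraph (Fin (k + 3))) := Finset.univ.filter fun G => G ∈ Eᶜ with hBdef
  have hmemR : ∀ σ : Equiv.Perm (Fin (k + 3)), (∀ v, σ (σ v) ≠ v) → permGraph σ ∈ R := by
    intro σ hσ
    rw [hRdef, Finset.mem_filter]
    exact ⟨Finset.mem_univ _, fun v => permGraph_degree hσ v⟩
  have hR : (k + 3).factorial ≤ R.card * (k + 3) ^ 2 := factorial_le_card_mul k R hmemR
  have hRpos : 0 < R.card := by
    rcases Nat.eq_zero_or_pos R.card with h | h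
    · rw [h, zero_mul] at hR
      exact absurd hR (Nat.factorial_pos _).not_ge
    · exact h
  have hRB : (R ∩ B).card * 2 ^ t ≤ (k + 3).factorial := by
    have := card_mul_two_pow_le (R ∩ B) t ?_
    · rwa [Fintype.card_fin] at this
    · intro G hG
      rw [Finset.mem_inter, Finset.mem_filter, Finset.mem_filter] at hG
      obtain ⟨σ, hσ, rfl⟩ := exists_eq_permGraph (G := G) hG.1.2
      refine ⟨σ, hσ, rfl, ?_⟩
      by_contra! hlt
      exact hG.2.2 (hE σ hσ hlt)
  have hmain : (R ∩ B).card * (k + 3) ≤ R.card := by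
    refine Nat.le_of_mul_le_mul_right ?_ (by positivity : 0 < (k + 3) ^ 2)
    calc (R ∩ B).card * (k + 3) * (k + 3) ^ 2 = (R ∩ B).card * (k + 3) ^ 3 := by ring
      _ ≤ (R ∩ B).card * 2 ^ t := Nat.mul_le_mul_left _ ht
      _ ≤ R.card * (k + 3) ^ 2 := hRB.trans hR
  have hRset : regularGraphs (k + 3) 2 = (R : Set (SimpleGraph (Fin (k + 3)))) := by
    ext G
    simp [hRdef]
  have hBset : Eᶜ = (B : Set (SimpleGraph (Fin (k + 3)))) := by
    ext G
    simp [hBdef]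
  have hcompl : randomRegular (k + 3) 2 Eᶜ ≤ ((k + 3 : ℕ) : ENNReal)⁻¹ := by
    rw [randomRegular, hRset, hBset, uniformOn_apply_finset' (measurableSet_of_finite _)
      (measurableSet_of_finite _)]
    refine ENNReal.div_le_of_le_mul ?_
    rw [mul_comm, ← div_eq_mul_inv, ENNReal.le_div_iff_mul_le (Or.inl (by simp)) (Or.inl (by simp))]
    exact_mod_cast hmain
  have : MeasurableSingletonClass (SimpleGraph (Fin (k + 3))) :=
    ⟨fun _ => measurableSet_of_finite _⟩
  have : IsProbabilityMeasure (randomRegular (k + 3) 2) := by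
    rw [randomRegular, hRset]
    exact isProbabilityMeasure_uniformOn R.finite_toSet (Finset.card_pos.1 hRpos)
  rw [← compl_compl E, prob_compl_eq_one_sub (measurableSet_of_finite _)]
  exact tsub_le_tsub_left hcompl 1

end SimpleGraph

lemma natLog_div_isLittleO :
    (fun n : ℕ => ((3 * (Nat.log 2 n + 1) : ℕ) : ℝ) / (n : ℝ)) =o[atTop]
      (fun n : ℕ => Real.log (n : ℝ) ^ 2 / (n : ℝ)) := by
  have hlog : Tendsto (fun n : ℕ => Real.log (n : ℝ)) atTop atTop :=
    Real.tendsto_log_atTop.comp tendsto_natCast_atTop_atTop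
  have h1 : (fun n : ℕ => ((3 * (Nat.log 2 n + 1) : ℕ) : ℝ)) =O[atTop]
      (fun n : ℕ => Real.log (n : ℝ)) := by
    refine IsBigO.of_bound (3 * (1 / Real.log 2 + 1)) ?_
    filter_upwards [hlog.eventually_ge_atTop 1] with n hn
    have h2 : (Nat.log 2 n : ℝ) ≤ Real.log n / Real.log 2 := by
      have := Real.natLog_le_logb n 2
      rwa [Real.logb, Nat.cast_ofNat] at this
    rw [Real.norm_of_nonneg (Nat.cast_nonneg _), Real.norm_of_nonneg (by linarith)]
    push_cast
    have h3 : 3 * (1 / Real.log 2 + 1) * Real.log n =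
        3 * (Real.log n / Real.log 2 + Real.log n) := by ring
    rw [h3]
    linarith
  have h2 : (fun n : ℕ => Real.log (n : ℝ)) =o[atTop] (fun n : ℕ => Real.log (n : ℝ) ^ 2) := by
    have := (isLittleO_pow_pow_atTop_of_lt (𝕜 := ℝ) one_lt_two).comp_tendsto hlog
    simpa [Function.comp_def] using this
  simpa only [div_eq_mul_inv] using
    (h1.trans_isLittleO h2).mul_isBigO (isBigO_refl (fun n : ℕ => ((n : ℝ))⁻¹) atTop)

theorem mainTheorem8 :
    ∃ f : ℕ → ℝ,
      f =o[atTop] (fun n : ℕ => Real.log (n : ℝ) ^ 2 / (n : ℝ)) ∧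
      WithHighProbability (fun n => SimpleGraph.randomRegular n 2)
        (fun n => {G : SimpleGraph (Fin n) |
          |G.modularity - (1 - 2 / Real.sqrt (n : ℝ))| ≤ f n}) := by
  -- The numerator is the cycle threshold `t`: n < 2^(log₂ n + 1), with rounded-down logarithm,
  -- gives n^3 ≤ 2^t.
  refine ⟨fun n => ((3 * (Nat.log 2 n + 1) : ℕ) : ℝ) / (n : ℝ), natLog_div_isLittleO, ?_⟩
  have hlim : Tendsto (fun n : ℕ => 1 - (n : ENNReal)⁻¹) atTop (𝓝 1) := by
    simpa using ENNReal.Tendsto.sub tendsto_const_nhds ENNReal.tendsto_inv_nat_nhds_zero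
      (Or.inl ENNReal.one_ne_top)
  refine tendsto_of_tendsto_of_tendsto_of_le_of_le' hlim tendsto_const_nhds ?_ ?_
  · filter_upwards [eventually_ge_atTop 3] with n hn
    obtain ⟨k, rfl⟩ := Nat.exists_eq_add_of_le' hn
    refine SimpleGraph.one_sub_inv_le_randomRegular_two k (3 * (Nat.log 2 (k + 3) + 1)) ?_ _ ?_
    · rw [mul_comm, pow_mul]
      exact Nat.pow_le_pow_left (Nat.lt_pow_succ_log_self one_lt_two _).le 3
    · intro σ hσ hlt
      have h := SimpleGraph.abs_modularity_permGraph_sub_le hσ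
      rw [Fintype.card_fin] at h
      refine h.trans (div_le_div_of_nonneg_right ?_ (Nat.cast_nonneg _))
      -- The strict inequality absorbs the `+ 1` of the deterministic bound.
      exact_mod_cast hlt
  -- For small `n` there may be no 2-regular graph and the law is then zero, hence the weaker
  -- instance.
  · refine Eventually.of_forall fun n => ?_
    have : IsZeroOrProbabilityMeasure (SimpleGraph.randomRegular n 2) := by
      unfold SimpleGraph.randomRegular
      infer_instance
    exact prob_le_one
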